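/- Let $n \ge 0$ be an integer and let $f : \mathbb{R}^n \to \mathbb{R}^n$ be real analytic (at every point of $\mathbb{R}^n$) and nonexpansive for the norm $\|x\|_\infty = \max_i |x_i|$, i.e. $\|f(x)-f(y)\|_\infty \le \|x-y\|_\infty$ for all $x, y \in \mathbb{R}^n$. Let $x \in \mathbb{R}^n$ be a periodic point of $f$, i.e. $f^k(x) = x$ for some $k \ge 1$, and let $p$ be its minimal period, i.e. the least such $k$ (equivalently, the number of elements of the orbit of $x$). Then $p \le 2^n$ (Nussbaum's $2^n$ conjecture for real analytic maps). If moreover $n \ge 3$, then $p < 2^n$. -/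

import Mathlib

/-!
The set `E` of fixed points of `g = f^[p]`, where `p` is the period, turns out to be a copy of
`ℓ_∞^m` with `m ≤ n` on which `f` acts as an isometric bijection; hence `f` acts there as a signed
permutation of `m` coordinates (`LinearIsometryEquiv.exists_signed_perm`). Such a permutation has
order at most `2 ^ m`, with strict inequality for `m ≥ 3` (`two_mul_orderOf_perm_le`); if
`m < 3 ≤ n`, then already `2 ^ m < 2 ^ n`.

The structure of `E` comes from signed sets of coordinates `(I, s)` that are *rigid* at a point `u`:
`g` preserves the coordinates in `I` of every `x` with `x = u + t s` on `I`.

* If `u, v ∈ E`, the coordinates `I` realising `‖v - u‖` are preserved by `g` on the segment from `u`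
  to `v` by nonexpansiveness, hence on the whole line by analyticity. Comparing an arbitrary point
  with far away points of the line shows that `I` is rigid at `u`
  (`IsRigid.of_fixed`).
* Rigid sets may be intersected (`IsRigid.inter`). The two rigid sets give bounds which, on a suitable
  open region, squeeze `g` from below and from above on the intersection; analyticity
  propagates the resulting identity. Therefore minimal rigid sets are pairwise disjoint.
* On a minimal rigid set `(I, s)`, the difference of any two points of `E` is a multiple of `s`
  (`IsMinRigid.exists_eq`), so minimal rigid sets do not depend on the base point.

Since a nonexpansive map has a fixed point in each invariant nonempty compact convex set, the values
of points of `E` on one representative coordinate of each minimal rigid set can be prescribed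
arbitrarily, and they determine distances in `E`. This is the isometry `E ≃ ℓ_∞^m`
(`exists_isometryEquiv_fixedPoints`). The Mazur–Ulam theorem makes `f` linear on
`E`, based at a fixed point of `f`.
-/

open Filter Topology Function

/-! ### Nonexpansive maps on compact convex sets -/

/-- The strict contractions `y ↦ l • c + (1 - l) • g y` have fixed points, which `g` moves little as
`l → 0`; so the minimal displacement of `g` on `C` is zero. -/
theorem exists_isFixedPt_of_compact_convex {E : Type*} [NormedAddCommGroup E] [NormedSpace ℝ E]
    {g : E → E} (hg : ∀ x y, ‖g x - g y‖ ≤ ‖x - y‖) {C : Set E} (hC : IsCompact C)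
    (hconv : Convex ℝ C) (hne : C.Nonempty) (hmaps : Set.MapsTo g C C) :
    ∃ z ∈ C, g z = z := by
  have hgc : Continuous g :=
    (LipschitzWith.of_dist_le_mul (K := 1) fun x y => by
      simpa [dist_eq_norm] using hg x y).continuous
  obtain ⟨c, hc⟩ := hne
  obtain ⟨D, hD⟩ := hC.isBounded.exists_norm_le
  have hD0 : 0 ≤ D := (norm_nonneg c).trans (hD c hc)
  have approx : ∀ l : ℝ, 0 < l → l < 1 → ∃ y ∈ C, ‖g y - y‖ ≤ l * (2 * D) := by
    intro l hl0 hl1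
    let h : E → E := fun y => l • c + (1 - l) • g y
    have hh : ∀ y ∈ C, h y ∈ C := fun y hy =>
      hconv hc (hmaps hy) hl0.le (by linarith) (by ring)
    have hcont : Continuous fun y => ‖h y - y‖ := by fun_prop
    obtain ⟨y, hy, hmin⟩ := hC.exists_isMinOn ⟨c, hc⟩ hcont.continuousOn
    -- The minimal displacement of the strict contraction `h` vanishes.
    have h1 : ‖h y - y‖ ≤ ‖h (h y) - h y‖ := hmin (hh y hy)
    have h2 : ‖h (h y) - h y‖ ≤ (1 - l) * ‖h y - y‖ := by
      have : h (h y) - h y = (1 - l) • (g (h y) - g y) := by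
        simp only [h]; module
      rw [this, norm_smul, Real.norm_of_nonneg (by linarith)]
      exact mul_le_mul_of_nonneg_left (hg _ _) (by linarith)
    have h3 : ‖h y - y‖ = 0 := by nlinarith [norm_nonneg (h y - y)]
    have h4 : h y = y := sub_eq_zero.mp (norm_eq_zero.mp h3)
    refine ⟨y, hy, ?_⟩
    have h5 : g y - y = l • (g y - c) := by
      nth_rewrite 2 [← h4]
      simp only [h]; module
    rw [h5, norm_smul, Real.norm_of_nonneg hl0.le]
    refine mul_le_mul_of_nonneg_left ?_ hl0.le
    have := norm_sub_le (g y) c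
    linarith [hD _ (hmaps hy), hD c hc]
  have hcont : Continuous fun y => ‖g y - y‖ := by fun_prop
  obtain ⟨z, hz, hmin⟩ := hC.exists_isMinOn ⟨c, hc⟩ hcont.continuousOn
  refine ⟨z, hz, sub_eq_zero.mp (norm_eq_zero.mp (le_antisymm ?_ (norm_nonneg _)))⟩
  have hev : ∀ᶠ l : ℝ in 𝓝[>] 0, ‖g z - z‖ ≤ l * (2 * D) := by
    filter_upwards [self_mem_nhdsWithin, nhdsWithin_le_nhds (Iio_mem_nhds (zero_lt_one' ℝ))]
      with l hl0 hl1
    obtain ⟨y, hy, hyl⟩ := approx l hl0 hl1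
    exact le_trans (hmin hy) hyl
  have hlim : Tendsto (fun l : ℝ => l * (2 * D)) (𝓝[>] 0) (𝓝 0) := by
    have : Tendsto (fun l : ℝ => l * (2 * D)) (𝓝 0) (𝓝 (0 * (2 * D))) :=
      (continuous_id.mul continuous_const).tendsto 0
    rw [zero_mul] at this
    exact this.mono_left nhdsWithin_le_nhds
  exact ge_of_tendsto hlim hev

/-- A periodic orbit of a nonexpansive map forces a fixed point: the points within a fixed large
distance of the whole orbit form an invariant compact convex set. -/
theorem exists_isFixedPt_of_mem_periodicPts {E : Type*} [NormedAddCommGroup E] [NormedSpace ℝ E]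
    [ProperSpace E] {f : E → E} (hf : ∀ x y, ‖f x - f y‖ ≤ ‖x - y‖) {x : E}
    (hx : x ∈ periodicPts f) : ∃ u, f u = u := by
  have hp := minimalPeriod_pos_of_mem_periodicPts hx
  set p := minimalPeriod f x with hpdef
  let R : ℝ := ∑ k ∈ Finset.range p, ‖x - f^[k] x‖
  let C : Set E := ⋂ k : ℕ, Metric.closedBall (f^[k] x) R
  have hmem : ∀ y, y ∈ C ↔ ∀ k, ‖y - f^[k] x‖ ≤ R := fun y => by
    simp [C, dist_eq_norm]
  have hxC : x ∈ C := by
    rw [hmem]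
    intro k
    rw [← iterate_mod_minimalPeriod_eq]
    exact Finset.single_le_sum (f := fun k => ‖x - f^[k] x‖) (fun _ _ => norm_nonneg _)
      (Finset.mem_range.mpr (Nat.mod_lt _ hp))
  have hcpt : IsCompact C :=
    (isCompact_closedBall (f^[0] x) R).of_isClosed_subset
      (isClosed_iInter fun k => Metric.isClosed_closedBall) (Set.iInter_subset _ 0)
  obtain ⟨u, -, hu⟩ := exists_isFixedPt_of_compact_convex hf hcpt
    (convex_iInter fun k => convex_closedBall _ _) ⟨x, hxC⟩ (by
      intro y hy
      rw [hmem] at hy ⊢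
      have hstep : ∀ k, ‖f y - f^[k + 1] x‖ ≤ R := fun k => by
        rw [iterate_succ_apply']
        exact (hf _ _).trans (hy k)
      rintro (_ | k)
      · have := hstep (p - 1)
        rwa [Nat.sub_add_cancel hp, hpdef, iterate_minimalPeriod] at this
      · exact hstep k)
  exact ⟨u, hu⟩

/-! ### Rigid signed sets of coordinates -/

section Rigid

variable {ι : Type*} {g : (ι → ℝ) → (ι → ℝ)}

/-- The signed set of coordinates `(I, s)` is rigid for `g` at `u`: the map `g` preserves the
coordinates in `I` of every point `x` with `x = u + t s` on `I` for some `t`. Only the values of `s`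
on `I` matter, and these are signs. -/
def IsRigid (g : (ι → ℝ) → (ι → ℝ)) (u : ι → ℝ) (I : Finset ι) (s : ι → ℝ) : Prop :=
  (∀ i ∈ I, s i = 1 ∨ s i = -1) ∧
    ∀ (x : ι → ℝ) (t : ℝ), (∀ i ∈ I, x i = u i + t * s i) → ∀ i ∈ I, g x i = x i

/-- A nonempty rigid signed set without proper nonempty rigid subsets of the same signs. -/
def IsMinRigid (g : (ι → ℝ) → (ι → ℝ)) (u : ι → ℝ) (I : Finset ι) (s : ι → ℝ) : Prop :=
  I.Nonempty ∧ IsRigid g u I s ∧ ∀ K ⊆ I, K.Nonempty → IsRigid g u K s → K = I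

theorem IsRigid.neg {u : ι → ℝ} {I : Finset ι} {s : ι → ℝ} (h : IsRigid g u I s) :
    IsRigid g u I (-s) :=
  ⟨fun i hi => by rcases h.1 i hi with h | h <;> simp [h],
    fun x t hx => h.2 x (-t) fun i hi => by rw [hx i hi, Pi.neg_apply]; ring⟩

theorem IsRigid.congr {u : ι → ℝ} {I : Finset ι} {s s' : ι → ℝ} (h : IsRigid g u I s)
    (hs : ∀ i ∈ I, s i = s' i) : IsRigid g u I s' :=
  ⟨fun i hi => hs i hi ▸ h.1 i hi,
    fun x t hx => h.2 x t fun i hi => by rw [hx i hi, hs i hi]⟩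

theorem IsRigid.change_base {u v : ι → ℝ} {I : Finset ι} {s : ι → ℝ} (h : IsRigid g u I s) {c : ℝ}
    (hv : ∀ i ∈ I, v i = u i + c * s i) : IsRigid g v I s :=
  ⟨h.1, fun x t hx => h.2 x (c + t) fun i hi => by rw [hx i hi, hv i hi]; ring⟩

theorem IsRigid.exists_isMinRigid {u : ι → ℝ} {I : Finset ι} {s : ι → ℝ} (h : IsRigid g u I s)
    (hI : I.Nonempty) : ∃ K ⊆ I, IsMinRigid g u K s := by
  obtain ⟨K, hKI, hK⟩ :=
    exists_minimal_le_of_wellFoundedLT (fun K : Finset ι => K.Nonempty ∧ IsRigid g u K s) I ⟨hI, h⟩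
  exact ⟨K, hKI, hK.prop.1, hK.prop.2, fun L hL hne hr => hL.antisymm (hK.2 ⟨hne, hr⟩ hL)⟩

theorem IsMinRigid.change_base {u v : ι → ℝ} {I : Finset ι} {s : ι → ℝ} (h : IsMinRigid g u I s)
    {c : ℝ} (hv : ∀ i ∈ I, v i = u i + c * s i) : IsMinRigid g v I s :=
  ⟨h.1, h.2.1.change_base hv, fun K hK hKne hr => h.2.2 K hK hKne
    (hr.change_base (c := -c) fun i hi => by rw [hv i (hK hi)]; ring)⟩

/-! ### Analytic continuation along lines -/

variable [Fintype ι]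

theorem AnalyticOnNhd.eq_affine_on_line (hg : AnalyticOnNhd ℝ g Set.univ) {a w : ι → ℝ} {i : ι}
    {c d t₀ : ℝ} (h : ∀ᶠ t in 𝓝 t₀, g (a + t • w) i = c + t * d) (t : ℝ) :
    g (a + t • w) i = c + t * d := by
  have h1 : AnalyticOnNhd ℝ (fun t : ℝ => g (a + t • w) i) Set.univ := by
    intro t _
    have hl : AnalyticAt ℝ (fun t : ℝ => a + t • w) t := by fun_prop
    have hgl : AnalyticAt ℝ (fun t : ℝ => g (a + t • w)) t :=
      AnalyticAt.fun_comp (hg _ (Set.mem_univ _)) hl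
    exact ((ContinuousLinearMap.proj (R := ℝ) (φ := fun _ : ι => ℝ) i).analyticAt _).fun_comp hgl
  have h2 : AnalyticOnNhd ℝ (fun t : ℝ => c + t * d) Set.univ := fun t _ => by fun_prop
  exact congrFun (h1.eq_of_eventuallyEq h2 h) t

/-- A coordinate realising the distance of two points, and preserved at both of them, is preserved
on the whole line through them. -/
theorem preserves_coord_on_line (hg : AnalyticOnNhd ℝ g Set.univ)
    (hne : ∀ x y, ‖g x - g y‖ ≤ ‖x - y‖) {u w : ι → ℝ} {i : ι} (hu : g u i = u i)
    (hv : g (u + w) i = u i + w i) (hi : |w i| = ‖w‖) (t : ℝ) :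
    g (u + t • w) i = u i + t * w i := by
  refine hg.eq_affine_on_line (t₀ := 1 / 2) ?_ t
  filter_upwards [Ioo_mem_nhds (show (0 : ℝ) < 1 / 2 by norm_num)
    (show (1 / 2 : ℝ) < 1 by norm_num)] with t ht
  have h1 : |g (u + t • w) i - u i| ≤ t * |w i| := by
    have h := (norm_le_pi_norm (g (u + t • w) - g u) i).trans (hne _ _)
    rwa [Pi.sub_apply, hu, add_sub_cancel_left, norm_smul, Real.norm_of_nonneg ht.1.le,
      ← hi] at h
  have h2 : |g (u + t • w) i - (u i + w i)| ≤ (1 - t) * |w i| := by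
    have h := (norm_le_pi_norm (g (u + w) - g (u + t • w)) i).trans (hne _ _)
    have e : u + w - (u + t • w) = (1 - t) • w := by module
    have ht1 : 0 ≤ 1 - t := by linarith [ht.2]
    rwa [Pi.sub_apply, hv, e, norm_smul, Real.norm_of_nonneg ht1, ← hi,
      Real.norm_eq_abs, abs_sub_comm] at h
  rw [abs_le] at h1 h2
  rcases abs_cases (w i) with ⟨h, -⟩ | ⟨h, -⟩ <;> rw [h] at h1 h2 <;>
    linarith [h1.1, h1.2, h2.1, h2.2]

/-! ### Rigidity from fixed points, and intersections of rigid sets -/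

/-- Comparison of `x` with the far away points of a line whose coordinates in `I` are preserved and
which moves fastest in these coordinates. -/
theorem le_of_preserves_line (hne : ∀ x y, ‖g x - g y‖ ≤ ‖x - y‖) {u w : ι → ℝ} {I : Finset ι}
    {s : ι → ℝ} (hs : ∀ i ∈ I, s i = 1 ∨ s i = -1) {N : ℝ} (hN : 0 < N)
    (hwI : ∀ i ∈ I, w i = N * s i) (hwI' : ∀ i ∉ I, |w i| < N)
    (hline : ∀ i ∈ I, ∀ t : ℝ, g (u + t • w) i = u i + t * w i) {x : ι → ℝ} {c : ℝ}
    (hc : ∀ i ∈ I, c ≤ s i * (x i - u i)) {i : ι} (hi : i ∈ I) : c ≤ s i * (g x i - u i) := by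
  have hfar : ∀ᶠ t : ℝ in atTop, ∀ k, |x k - (u k + t * w k)| ≤ t * N - c := by
    rw [eventually_all]
    intro k
    by_cases hk : k ∈ I
    · filter_upwards [eventually_ge_atTop ((s k * (x k - u k) + c) / (2 * N))] with t ht
      rw [div_le_iff₀ (by positivity)] at ht
      have h1 := hc k hk
      rw [hwI k hk, abs_le]
      rcases hs k hk with h | h <;> rw [h] at ht h1 ⊢ <;> constructor <;> linarith
    · have hpos : 0 < N - |w k| := by linarith [hwI' k hk]
      filter_upwards [eventually_ge_atTop ((c + |x k - u k|) / (N - |w k|)),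
        eventually_ge_atTop 0] with t ht ht0
      rw [div_le_iff₀ hpos] at ht
      have h1 : |x k - (u k + t * w k)| ≤ |x k - u k| + t * |w k| := by
        rw [← sub_sub]
        refine (abs_sub _ _).trans ?_
        rw [abs_mul, abs_of_nonneg ht0]
      linarith
  obtain ⟨t, ht⟩ := hfar.exists
  have : Nonempty ι := ⟨i⟩
  have hle : ‖x - (u + t • w)‖ ≤ t * N - c := (pi_norm_le_iff_of_nonempty _).mpr ht
  have h1 := ((norm_le_pi_norm (g x - g (u + t • w)) i).trans (hne _ _)).trans hle
  rw [Pi.sub_apply, hline i hi, hwI i hi, Real.norm_eq_abs, abs_le] at h1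
  rcases hs i hi with h | h <;> rw [h] at h1 ⊢ <;> linarith [h1.1, h1.2]

theorem IsRigid.of_preserves_line (hne : ∀ x y, ‖g x - g y‖ ≤ ‖x - y‖) {u w : ι → ℝ}
    {I : Finset ι} {s : ι → ℝ} (hs : ∀ i ∈ I, s i = 1 ∨ s i = -1) {N : ℝ} (hN : 0 < N)
    (hwI : ∀ i ∈ I, w i = N * s i) (hwI' : ∀ i ∉ I, |w i| < N)
    (hline : ∀ i ∈ I, ∀ t : ℝ, g (u + t • w) i = u i + t * w i) : IsRigid g u I s := by
  refine ⟨hs, fun x t hx i hi => ?_⟩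
  have lower : t ≤ s i * (g x i - u i) :=
    le_of_preserves_line hne hs hN hwI hwI' hline (fun k hk => by
      rw [hx k hk]; rcases hs k hk with h | h <;> rw [h] <;> linarith) hi
  -- The upper bound is the lower bound for the reversed line and the opposite signs.
  have upper : -t ≤ (-s) i * (g x i - u i) :=
    le_of_preserves_line (w := -w) hne
      (fun k hk => by rcases hs k hk with h | h <;> simp [h]) hN
      (fun k hk => by simp [hwI k hk]) (fun k hk => by simpa using hwI' k hk)
      (fun k hk r => by
        have := hline k hk (-r)
        rw [smul_neg, ← neg_smul, this, Pi.neg_apply]; ring)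
      (fun k hk => by
        rw [hx k hk, Pi.neg_apply]; rcases hs k hk with h | h <;> rw [h] <;> linarith) hi
  rw [Pi.neg_apply] at upper
  rw [hx i hi]
  rcases hs i hi with h | h <;> rw [h] at lower upper ⊢ <;> linarith

/-- On a rigid set, `g` does not decrease the least signed deviation from the base point. -/
theorem IsRigid.le (hne : ∀ x y, ‖g x - g y‖ ≤ ‖x - y‖) {u : ι → ℝ} {I : Finset ι} {s : ι → ℝ}
    (h : IsRigid g u I s) {x : ι → ℝ} {c : ℝ} (hc : ∀ i ∈ I, c ≤ s i * (x i - u i)) {i : ι}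
    (hi : i ∈ I) : c ≤ s i * (g x i - u i) := by
  classical
  refine le_of_preserves_line (w := fun k => if k ∈ I then s k else 0) hne h.1 one_pos
    (fun k hk => by simp [hk]) (fun k hk => by simp [hk]) (fun k hk t => ?_) hc hi
  rw [h.2 (u + t • fun k => if k ∈ I then s k else 0) t (fun j hj => by simp [hj]) k hk]
  simp

theorem IsRigid.ge (hne : ∀ x y, ‖g x - g y‖ ≤ ‖x - y‖) {u : ι → ℝ} {I : Finset ι} {s : ι → ℝ}
    (h : IsRigid g u I s) {x : ι → ℝ} {c : ℝ} (hc : ∀ i ∈ I, s i * (x i - u i) ≤ c) {i : ι}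
    (hi : i ∈ I) : s i * (g x i - u i) ≤ c := by
  have := h.neg.le hne (x := x) (c := -c) (fun k hk => by
    rw [Pi.neg_apply]; linarith [hc k hk]) hi
  rw [Pi.neg_apply] at this
  linarith

/-- The coordinates realising the distance of two points, if preserved at both of them, form a rigid
set. -/
theorem IsRigid.of_fixed (hg : AnalyticOnNhd ℝ g Set.univ)
    (hne : ∀ x y, ‖g x - g y‖ ≤ ‖x - y‖) {u v : ι → ℝ} {I : Finset ι} {s : ι → ℝ}
    (hs : ∀ i ∈ I, s i = 1 ∨ s i = -1) {N : ℝ} (hN : 0 < N)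
    (hwI : ∀ i ∈ I, v i - u i = N * s i) (hwI' : ∀ i ∉ I, |v i - u i| < N)
    (hu : ∀ i ∈ I, g u i = u i) (hv : ∀ i ∈ I, g v i = v i) : IsRigid g u I s := by
  refine IsRigid.of_preserves_line (w := v - u) hne hs hN hwI hwI' fun i hi => ?_
  have habs : ∀ k ∈ I, |v k - u k| = N := fun k hk => by
    rw [hwI k hk, abs_mul, abs_of_pos hN]
    rcases hs k hk with h | h <;> simp [h]
  refine preserves_coord_on_line hg hne (hu i hi) (by simpa using hv i hi) (le_antisymm ?_ ?_)
  · exact norm_le_pi_norm (v - u) i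
  · rw [Pi.sub_apply, habs i hi, pi_norm_le_iff_of_nonneg hN.le]
    intro k
    by_cases hk : k ∈ I
    · exact (habs k hk).le
    · exact (hwI' k hk).le

/-- The part of two rigid sets on which their signs agree is rigid. -/
theorem IsRigid.inter [DecidableEq ι] (hg : AnalyticOnNhd ℝ g Set.univ)
    (hne : ∀ x y, ‖g x - g y‖ ≤ ‖x - y‖) {u : ι → ℝ} {I I' : Finset ι} {s s' : ι → ℝ}
    (h : IsRigid g u I s) (h' : IsRigid g u I' s') :
    IsRigid g u {i ∈ I ∩ I' | s i = s' i} s := by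
  refine ⟨fun i hi => h.1 i (by simp at hi; exact hi.1.1), fun x t hx i hi => ?_⟩
  -- Off the intersection, `x₀` lies strictly above level `t` on `I` and strictly below it on `I'`;
  -- using `|t| + 1` makes both true also where the signs of the two sets are opposite.
  let x₀ : ι → ℝ := fun k =>
    if k ∈ I ∩ I' ∧ s k = s' k then u k + t * s k
    else if k ∈ I then u k + (|t| + 1) * s k else u k - (|t| + 1) * s' k
  have hat := neg_abs_le t
  have hat' := le_abs_self t
  have hK : ∀ k ∈ I ∩ I', s k = s' k → ∀ r : ℝ, (x₀ + r • (x - x₀)) k = u k + t * s k := by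
    intro k hk hsk r
    have hxk := hx k (by simp only [Finset.mem_filter]; exact ⟨hk, hsk⟩)
    have hx0 : x₀ k = u k + t * s k := if_pos ⟨hk, hsk⟩
    simp [hxk, hx0]
  have hcont : ∀ k, Continuous fun r : ℝ => (x₀ + r • (x - x₀)) k := fun k => by
    simp only [Pi.add_apply, Pi.smul_apply, smul_eq_mul]
    fun_prop
  have hI : ∀ᶠ r : ℝ in 𝓝 0, ∀ k ∈ I, t ≤ s k * ((x₀ + r • (x - x₀)) k - u k) := by
    rw [Filter.eventually_all_finset]
    intro k hk
    by_cases hkK : k ∈ I ∩ I' ∧ s k = s' k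
    · refine Eventually.of_forall fun r => ?_
      rw [hK k hkK.1 hkK.2 r]
      rcases h.1 k hk with e | e <;> rw [e] <;> linarith
    · have hx0 : x₀ k = u k + (|t| + 1) * s k := by simp only [x₀]; rw [if_neg hkK, if_pos hk]
      have : t < s k * ((x₀ + (0 : ℝ) • (x - x₀)) k - u k) := by
        rw [zero_smul, add_zero, hx0]
        rcases h.1 k hk with e | e <;> rw [e] <;> linarith
      have hc : Continuous fun r : ℝ => s k * ((x₀ + r • (x - x₀)) k - u k) :=
        continuous_const.mul ((hcont k).sub continuous_const)
      exact (hc.continuousAt.eventually_const_lt this).mono fun r hr => hr.le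
  have hI' : ∀ᶠ r : ℝ in 𝓝 0, ∀ k ∈ I', s' k * ((x₀ + r • (x - x₀)) k - u k) ≤ t := by
    rw [Filter.eventually_all_finset]
    intro k hk
    by_cases hkK : k ∈ I ∩ I' ∧ s k = s' k
    · refine Eventually.of_forall fun r => ?_
      rw [hK k hkK.1 hkK.2 r, hkK.2]
      rcases h'.1 k hk with e | e <;> rw [e] <;> linarith
    · have : s' k * ((x₀ + (0 : ℝ) • (x - x₀)) k - u k) < t := by
        rw [zero_smul, add_zero]
        by_cases hkI : k ∈ I
        · have hx0 : x₀ k = u k + (|t| + 1) * s k := by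
            simp only [x₀]; rw [if_neg hkK, if_pos hkI]
          have hopp : s k ≠ s' k := fun e => hkK ⟨Finset.mem_inter.mpr ⟨hkI, hk⟩, e⟩
          rw [hx0]
          rcases h.1 k hkI with e | e <;> rcases h'.1 k hk with e' | e' <;> rw [e, e'] <;>
            first | linarith | exact absurd (e.trans e'.symm) hopp
        · have hx0 : x₀ k = u k - (|t| + 1) * s' k := by
            simp only [x₀]; rw [if_neg hkK, if_neg hkI]
          rw [hx0]
          rcases h'.1 k hk with e | e <;> rw [e] <;> linarith
      have hc : Continuous fun r : ℝ => s' k * ((x₀ + r • (x - x₀)) k - u k) :=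
        continuous_const.mul ((hcont k).sub continuous_const)
      exact (hc.continuousAt.eventually_lt_const this).mono fun r hr => hr.le
  rw [Finset.mem_filter, Finset.mem_inter] at hi
  obtain ⟨⟨hiI, hiI'⟩, hsi⟩ := hi
  have key : ∀ᶠ r : ℝ in 𝓝 0, g (x₀ + r • (x - x₀)) i = (u i + t * s i) + r * 0 := by
    filter_upwards [hI, hI'] with r h1 h2
    have a1 := h.le hne h1 hiI
    have a2 := h'.ge hne h2 hiI'
    rw [← hsi] at a2
    rcases h.1 i hiI with e | e <;> rw [e] at a1 a2 ⊢ <;> linarith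
  have := hg.eq_affine_on_line key 1
  rw [one_smul, add_sub_cancel, mul_zero, add_zero] at this
  rw [this, hx i (by simp [hiI, hiI', hsi])]

/-! ### Minimal rigid sets -/

/-- Minimal rigid sets are equal as soon as they meet. -/
theorem IsMinRigid.eq_of_mem (hg : AnalyticOnNhd ℝ g Set.univ)
    (hne : ∀ x y, ‖g x - g y‖ ≤ ‖x - y‖) {u : ι → ℝ} {I I' : Finset ι} {s s' : ι → ℝ}
    (h : IsMinRigid g u I s) (h' : IsMinRigid g u I' s') {i : ι} (hi : i ∈ I) (hi' : i ∈ I') :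
    I = I' := by
  classical
  -- Reversing all signs of one set if necessary, the signs agree at the common element.
  wlog hsi : s i = s' i generalizing s'
  · refine this (s' := -s') ⟨h'.1, h'.2.1.neg, fun K hK hKne hr => h'.2.2 K hK hKne ?_⟩ ?_
    · simpa using hr.neg
    · rw [Pi.neg_apply]
      rcases h.2.1.1 i hi with e | e <;> rcases h'.2.1.1 i hi' with e' | e' <;>
        first | exact absurd (e.trans e'.symm) hsi | simp [e, e']
  have hr := h.2.1.inter hg hne h'.2.1
  have hKne : ({i ∈ I ∩ I' | s i = s' i} : Finset ι).Nonempty := ⟨i, by simp [hi, hi', hsi]⟩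
  have h1 := h.2.2 _ (fun k hk => by simp at hk; exact hk.1.1) hKne hr
  have h2 := h'.2.2 _ (fun k hk => by simp at hk; exact hk.1.2) hKne
    (hr.congr fun k hk => by simp at hk; exact hk.2)
  exact h1.symm.trans h2

/-- On a minimal rigid set `(I, s)`, two fixed points of `g` differ by a multiple of `s`. -/
theorem IsMinRigid.exists_eq (hg : AnalyticOnNhd ℝ g Set.univ)
    (hne : ∀ x y, ‖g x - g y‖ ≤ ‖x - y‖) {u v : ι → ℝ} {I : Finset ι} {s : ι → ℝ}
    (h : IsMinRigid g u I s) (hv : g v = v) : ∃ c : ℝ, ∀ i ∈ I, v i = u i + c * s i := by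
  classical
  obtain ⟨a, ha, hmin⟩ := I.exists_min_image (fun k => s k * (v k - u k)) h.1
  obtain ⟨b, hb, hmax⟩ := I.exists_max_image (fun k => s k * (v k - u k)) h.1
  set c := s a * (v a - u a) with hc
  set T := s b * (v b - u b) + 1 with hT
  let M : Finset ι := {k ∈ I | s k * (v k - u k) = c}
  have hMI : M ⊆ I := Finset.filter_subset _ _
  have hMv : ∀ k ∈ M, v k = u k + c * s k := fun k hk => by
    obtain ⟨hkI, hkc⟩ := Finset.mem_filter.mp hk
    rw [← hkc]
    rcases h.2.1.1 k hkI with e | e <;> rw [e] <;> ring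
  -- The coordinates realising the distance from `v` to `y` are those in `M`, and they are preserved
  -- at `y` since `I` is rigid. So `M` is rigid at `v`, hence at `u`.
  let y : ι → ℝ := fun k => if k ∈ I then u k + T * s k else v k
  have hy : ∀ k ∈ I, y k = u k + T * s k := fun k hk => if_pos hk
  have hcT : c < T := by have := hmax a ha; linarith
  have hMr : IsRigid g v M s := by
    refine IsRigid.of_fixed (v := y) (N := T - c) hg hne (fun i hi => h.2.1.1 i (hMI hi))
      (by linarith) (fun k hk => ?_) (fun k hk => ?_) (fun k _ => by rw [hv])
      (fun k hk => h.2.1.2 y T hy k (hMI hk))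
    · rw [hy k (hMI hk), hMv k hk]; ring
    · by_cases hkI : k ∈ I
      · have h1 : s k * (v k - u k) ≠ c := fun e => hk (Finset.mem_filter.mpr ⟨hkI, e⟩)
        have h2 := lt_of_le_of_ne (hmin k hkI) h1.symm
        have h3 := hmax k hkI
        rw [hy k hkI, abs_lt]
        rcases h.2.1.1 k hkI with e | e <;> rw [e] at h2 h3 ⊢ <;> constructor <;> linarith
      · have : y k = v k := if_neg hkI
        rw [this, sub_self, abs_zero]; linarith
  have hMu : IsRigid g u M s := hMr.change_base (c := -c) fun k hk => by rw [hMv k hk]; ring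
  have hM := h.2.2 M hMI ⟨a, Finset.mem_filter.mpr ⟨ha, rfl⟩⟩ hMu
  exact ⟨c, fun i hi => hMv i (hM ▸ hi)⟩

/-- The distance of two fixed points is realised on all of some minimal rigid set. -/
theorem exists_isMinRigid_forall_abs_eq (hg : AnalyticOnNhd ℝ g Set.univ)
    (hne : ∀ x y, ‖g x - g y‖ ≤ ‖x - y‖) {u v v' : ι → ℝ} (hu : g u = u) (hv : g v = v)
    (hv' : g v' = v') (hvv : v ≠ v') :
    ∃ I s, IsMinRigid g u I s ∧ ∀ i ∈ I, |v' i - v i| = ‖v' - v‖ := by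
  classical
  have hpos : 0 < ‖v' - v‖ := norm_pos_iff.mpr (sub_ne_zero.mpr hvv.symm)
  let I : Finset ι := {i | |v' i - v i| = ‖v' - v‖}
  have hmem : ∀ i, i ∈ I ↔ |v' i - v i| = ‖v' - v‖ := fun i => by simp [I]
  have hIne : I.Nonempty := by
    by_contra hemp
    have : ‖v' - v‖ < ‖v' - v‖ := (pi_norm_lt_iff hpos).mpr fun i =>
      lt_of_le_of_ne (norm_le_pi_norm (v' - v) i) fun e => hemp ⟨i, (hmem i).mpr e⟩
    exact lt_irrefl _ this
  let s : ι → ℝ := fun i => if 0 ≤ v' i - v i then 1 else -1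
  have hI : IsRigid g v I s := by
    refine IsRigid.of_fixed (v := v') hg hne (fun i _ => ?_) hpos (fun i hi => ?_) (fun i hi => ?_)
      (fun i _ => by rw [hv]) (fun i _ => by rw [hv'])
    · by_cases h : 0 ≤ v' i - v i
      · exact Or.inl (if_pos h)
      · exact Or.inr (if_neg h)
    · rw [← (hmem i).mp hi]
      by_cases h : 0 ≤ v' i - v i
      · simp only [s, if_pos h, abs_of_nonneg h, mul_one]
      · simp only [s, if_neg h, abs_of_neg (not_le.mp h)]; ring
    · exact lt_of_le_of_ne (norm_le_pi_norm (v' - v) i) fun e => hi ((hmem i).mpr e)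
  obtain ⟨K, hKI, hK⟩ := hI.exists_isMinRigid hIne
  obtain ⟨c, hc⟩ := hK.exists_eq hg hne hu
  exact ⟨K, s, hK.change_base hc, fun i hi => (hmem i).mp (hKI hi)⟩

/-! ### The fixed point set as a sup-normed space -/

/-- The fixed point set of a nonexpansive analytic map is isometric to some `κ → ℝ`, by an isometry
sending a given fixed point to the origin. -/
theorem exists_isometryEquiv_fixedPoints (hg : AnalyticOnNhd ℝ g Set.univ)
    (hne : ∀ x y, ‖g x - g y‖ ≤ ‖x - y‖) {u : ι → ℝ} (hu : g u = u) :
    ∃ (κ : Type) (_ : Fintype κ) (Φ : fixedPoints g ≃ᵢ (κ → ℝ)),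
      Fintype.card κ ≤ Fintype.card ι ∧ Φ ⟨u, hu⟩ = 0 := by
  classical
  -- The coordinates of the model are one representative of each minimal rigid set.
  let S : Type _ := {I : Finset ι // ∃ s, IsMinRigid g u I s}
  choose sg hsg using fun I : S => I.2
  choose rep hrep using fun I : S => (hsg I).1
  have hinj : Injective rep := fun I I' e => Subtype.ext <|
    (hsg I).eq_of_mem hg hne (hsg I') (hrep I) (e ▸ hrep I')
  have hcard : Fintype.card S ≤ Fintype.card ι := Fintype.card_le_of_injective rep hinj
  let e : Fin (Fintype.card S) ≃ S := (Fintype.equivFin S).symm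
  let φ : fixedPoints g → (Fin (Fintype.card S) → ℝ) := fun v j => v.1 (rep (e j)) - u (rep (e j))
  have hiso : Isometry φ := by
    refine Isometry.of_dist_eq fun v v' => ?_
    rw [Subtype.dist_eq, dist_eq_norm, dist_eq_norm]
    have hsub : ∀ j, (φ v - φ v') j = (v.1 - v'.1) (rep (e j)) := fun j => by simp [φ]
    refine le_antisymm ?_ ?_
    · refine (pi_norm_le_iff_of_nonneg (norm_nonneg _)).mpr fun j => ?_
      rw [hsub]
      exact norm_le_pi_norm _ _
    · by_cases hvv : v' = v
      · simp [hvv]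
      · obtain ⟨I, s, hI, habs⟩ := exists_isMinRigid_forall_abs_eq hg hne hu v'.2 v.2
          (fun h => hvv (Subtype.ext h))
        let J : S := ⟨I, s, hI⟩
        rw [← habs _ (hrep J)]
        have := norm_le_pi_norm (φ v - φ v') (e.symm J)
        rwa [hsub, Equiv.apply_symm_apply] at this
  have hsurj : Surjective φ := by
    intro a
    let t : S → ℝ := fun I => sg I (rep I) * a (e.symm I)
    let R : ℝ := ∑ I : S, |t I|
    -- Points with the prescribed values on all minimal rigid sets, not too far from `u`.
    let C : Set (ι → ℝ) := Metric.closedBall u R ∩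
      ⋂ (I : S) (i ∈ I.1), {x | x i = u i + t I * sg I i}
    have hmem : ∀ x, x ∈ C ↔ ‖x - u‖ ≤ R ∧ ∀ I : S, ∀ i ∈ I.1, x i = u i + t I * sg I i :=
      fun x => by simp [C, dist_eq_norm]
    have hclosed : IsClosed C := Metric.isClosed_closedBall.inter <|
      isClosed_iInter fun I => isClosed_biInter fun i _ =>
        isClosed_eq (continuous_apply i) continuous_const
    have hconv : Convex ℝ C := (convex_closedBall u R).inter <|
      convex_iInter fun I => convex_iInter fun i => convex_iInter fun _ =>
        convex_hyperplane (LinearMap.proj (R := ℝ) (φ := fun _ : ι => ℝ) i).isLinear _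
    have hnonempty : C.Nonempty := by
      refine ⟨fun i => if h : ∃ I : S, i ∈ I.1 then u i + t h.choose * sg h.choose i else u i,
        (hmem _).mpr ⟨?_, fun I i hi => ?_⟩⟩
      · have hR : 0 ≤ R := Finset.sum_nonneg fun _ _ => abs_nonneg _
        refine (pi_norm_le_iff_of_nonneg hR).mpr fun i => ?_
        rw [Pi.sub_apply]
        split_ifs with h
        · rw [add_sub_cancel_left, Real.norm_eq_abs, abs_mul]
          have h1 : |sg h.choose i| = 1 := by
            rcases (hsg h.choose).2.1.1 i h.choose_spec with e | e <;> simp [e]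
          rw [h1, mul_one]
          exact Finset.single_le_sum (f := fun I : S => |t I|) (fun _ _ => abs_nonneg _)
            (Finset.mem_univ _)
        · simpa using hR
      · have h : ∃ I : S, i ∈ I.1 := ⟨I, hi⟩
        have heq : h.choose = I := Subtype.ext <|
          (hsg _).eq_of_mem hg hne (hsg I) h.choose_spec hi
        simp only [dif_pos h, heq]
    obtain ⟨z, hzC, hz⟩ := exists_isFixedPt_of_compact_convex hne
      ((isCompact_closedBall u R).of_isClosed_subset hclosed Set.inter_subset_left) hconv hnonempty
      (fun x hx => by
        rw [hmem] at hx ⊢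
        refine ⟨?_, fun I i hi => ?_⟩
        · have := hne x u
          rw [hu] at this
          exact this.trans hx.1
        · rw [(hsg I).2.1.2 x (t I) (hx.2 I) i hi, hx.2 I i hi])
    refine ⟨⟨z, hz⟩, funext fun j => ?_⟩
    have := ((hmem z).mp hzC).2 (e j) _ (hrep (e j))
    simp only [φ, this, t, Equiv.symm_apply_apply, add_sub_cancel_left]
    rcases (hsg (e j)).2.1.1 _ (hrep (e j)) with h | h <;> rw [h] <;> ring
  refine ⟨Fin (Fintype.card S), inferInstance,
    ⟨Equiv.ofBijective φ ⟨hiso.injective, hsurj⟩, hiso⟩, by simpa using hcard, ?_⟩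
  funext j
  exact sub_self _

end Rigid

/-! ### Linear isometries of the sup norm -/

section Signed

variable {κ : Type*} [Fintype κ]

theorem sum_abs_le_of_linear_nonexpansive [DecidableEq κ] {A : (κ → ℝ) →ₗ[ℝ] (κ → ℝ)}
    (hA : ∀ x, ‖A x‖ ≤ ‖x‖) (i : κ) : ∑ j, |A (Pi.single j 1) i| ≤ 1 := by
  let y : κ → ℝ := fun j => if 0 ≤ A (Pi.single j 1) i then 1 else -1
  have hy : ‖y‖ ≤ 1 := (pi_norm_le_iff_of_nonneg zero_le_one).mpr fun j => by
    by_cases h : 0 ≤ A (Pi.single j 1) i <;> simp [y, h]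
  have hsum : A y i = ∑ j, |A (Pi.single j 1) i| := by
    rw [LinearMap.pi_apply_eq_sum_univ A y, Finset.sum_apply]
    refine Finset.sum_congr rfl fun j _ => ?_
    have hsingle : (fun k => if j = k then (1 : ℝ) else 0) = Pi.single j 1 := by
      funext k; simp [Pi.single_apply, eq_comm]
    rw [hsingle, Pi.smul_apply, smul_eq_mul]
    by_cases h : 0 ≤ A (Pi.single j 1) i
    · simp only [y, if_pos h, one_mul, abs_of_nonneg h]
    · simp only [y, if_neg h, abs_of_neg (not_le.mp h)]; ring
  calc ∑ j, |A (Pi.single j 1) i| = A y i := hsum.symm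
    _ ≤ ‖A y i‖ := le_abs_self _
    _ ≤ ‖A y‖ := norm_le_pi_norm _ _
    _ ≤ 1 := (hA y).trans hy

/-- A linear isometry of the sup norm is a signed permutation of the coordinates. -/
theorem LinearIsometryEquiv.exists_signed_perm (L : (κ → ℝ) ≃ₗᵢ[ℝ] (κ → ℝ)) :
    ∃ (τ : Equiv.Perm κ) (s : κ → ℝ), (∀ i, |s i| = 1) ∧ ∀ x i, L x i = s i * x (τ i) := by
  classical
  have expand : ∀ (A : (κ → ℝ) ≃ₗᵢ[ℝ] (κ → ℝ)) x i,
      A x i = ∑ j, A (Pi.single j 1) i * x j := fun A x i => by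
    conv_lhs => rw [pi_eq_sum_univ' x, map_sum, Finset.sum_apply]
    refine Finset.sum_congr rfl fun j _ => ?_
    rw [map_smul, Pi.smul_apply, smul_eq_mul, mul_comm]
  have hrow : ∀ (A : (κ → ℝ) ≃ₗᵢ[ℝ] (κ → ℝ)) i, ∑ j, |A (Pi.single j 1) i| ≤ 1 := fun A =>
    sum_abs_le_of_linear_nonexpansive (A := A.toLinearEquiv.toLinearMap) fun x =>
      (A.norm_map x).le
  -- A row of `A` containing an entry `±1` has no other nonzero entry.
  have hone : ∀ (A : (κ → ℝ) ≃ₗᵢ[ℝ] (κ → ℝ)) i j, |A (Pi.single j 1) i| = 1 →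
      ∀ x, A x i = A (Pi.single j 1) i * x j := by
    intro A i j hj x
    rw [expand A x i]
    refine Finset.sum_eq_single j (fun k _ hk => ?_) (by simp)
    have h1 := Finset.add_le_sum (f := fun j => |A (Pi.single j 1) i|) (s := Finset.univ)
      (fun _ _ => abs_nonneg _) (Finset.mem_univ j) (Finset.mem_univ k) hk.symm
    have h2 : |A (Pi.single k 1) i| = 0 :=
      le_antisymm (by linarith [hrow A i]) (abs_nonneg _)
    rw [abs_eq_zero.mp h2, zero_mul]
  -- The rows of a matrix and of its inverse have `ℓ₁`-norm at most `1`, so equality holds in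
  -- `1 = ∑ j, L i j * L⁻¹ j i`.
  have hex : ∀ i, ∃ j, |L (Pi.single j 1) i| = 1 := by
    intro i
    have hent : ∀ (A : (κ → ℝ) ≃ₗᵢ[ℝ] (κ → ℝ)) k l, |A (Pi.single k 1) l| ≤ 1 := fun A k l =>
      (Finset.single_le_sum (f := fun j => |A (Pi.single j 1) l|) (fun _ _ => abs_nonneg _)
        (Finset.mem_univ k)).trans (hrow A l)
    have hsum : ∑ j, L (Pi.single j 1) i * L.symm (Pi.single i 1) j = 1 := by
      rw [← expand, L.apply_symm_apply, Pi.single_eq_same]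
    obtain ⟨j, -, hj⟩ : ∃ j ∈ Finset.univ, L (Pi.single j 1) i ≠ 0 := by
      by_contra! h
      rw [Finset.sum_eq_zero fun j hj => by rw [h j hj, zero_mul]] at hsum
      exact zero_ne_one hsum
    have habs : |L.symm (Pi.single i 1) j| = 1 := by
      by_contra hlt
      have hlt := lt_of_le_of_ne (hent L.symm i j) hlt
      have : ∑ k, L (Pi.single k 1) i * L.symm (Pi.single i 1) k <
          ∑ k, |L (Pi.single k 1) i| := by
        refine Finset.sum_lt_sum (fun k _ => ?_) ⟨j, Finset.mem_univ j, ?_⟩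
        · refine (le_abs_self _).trans ?_
          rw [abs_mul]
          exact mul_le_of_le_one_right (abs_nonneg _) (hent L.symm i k)
        · refine (le_abs_self _).trans_lt ?_
          rw [abs_mul]
          exact mul_lt_of_lt_one_right (abs_pos.mpr hj) hlt
      linarith [hrow L i]
    have h1 := hone L.symm j i habs (L (Pi.single j 1))
    rw [L.symm_apply_apply, Pi.single_eq_same] at h1
    have h2 := congrArg abs h1
    rw [abs_one, abs_mul, habs, one_mul] at h2
    exact ⟨j, h2.symm⟩
  choose τ hτ using hex
  have hform : ∀ x i, L x i = L (Pi.single (τ i) 1) i * x (τ i) := fun x i =>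
    hone L i (τ i) (hτ i) x
  have hsurj : Surjective τ := by
    intro j
    by_contra! h
    have h0 : L (Pi.single j 1) = 0 := funext fun i => by
      rw [hform, Pi.single_eq_of_ne (h i), mul_zero, Pi.zero_apply]
    have := congrFun (L.injective (h0.trans (map_zero L).symm)) j
    simp at this
  exact ⟨Equiv.ofBijective τ (Finite.surjective_iff_bijective.mp hsurj),
    fun i => L (Pi.single (τ i) 1) i, hτ, hform⟩

end Signed

theorem iterate_two_mul_orderOf_eq {κ : Type*} {L : (κ → ℝ) → (κ → ℝ)} {τ : Equiv.Perm κ}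
    {s : κ → ℝ} (hs : ∀ i, |s i| = 1) (hL : ∀ x i, L x i = s i * x (τ i)) (x : κ → ℝ) :
    L^[2 * orderOf τ] x = x := by
  have hiter : ∀ k, ∃ r : κ → ℝ, (∀ i, |r i| = 1) ∧ ∀ x i, L^[k] x i = r i * x ((τ ^ k) i) := by
    intro k
    induction k with
    | zero => exact ⟨1, by simp, by simp⟩
    | succ k ih =>
      obtain ⟨r, hr, hLr⟩ := ih
      refine ⟨fun i => r i * s ((τ ^ k) i), fun i => by rw [abs_mul, hr, hs, one_mul],
        fun x i => ?_⟩
      rw [iterate_succ_apply, hLr, hL, pow_succ', Equiv.Perm.mul_apply, mul_assoc]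
  obtain ⟨r, hr, hLr⟩ := hiter (orderOf τ)
  funext i
  rw [two_mul, iterate_add_apply, hLr, hLr, pow_orderOf_eq_one, Equiv.Perm.one_apply, ← mul_assoc,
    ← abs_mul_abs_self, hr, one_mul, one_mul, Equiv.Perm.one_apply]

/-! ### Orders of permutations -/

/-- The least common multiple is at most the product, and `a ≤ 2 ^ (a - 1)` for each factor. -/
theorem Multiset.lcm_le_two_pow (S : Multiset ℕ) (hS : ∀ a ∈ S, 1 ≤ a) :
    S.lcm * 2 ^ S.card ≤ 2 ^ S.sum := by
  induction S using Multiset.induction with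
  | empty => simp
  | cons a S ih =>
    have ih := ih fun b hb => hS b (Multiset.mem_cons_of_mem hb)
    have ha := hS a (Multiset.mem_cons_self a S)
    rw [Multiset.lcm_cons, Multiset.card_cons, Multiset.sum_cons]
    have hlcm : GCDMonoid.lcm a S.lcm ≤ a * S.lcm := Nat.div_le_self _ _
    have h2a : a * 2 ≤ 2 ^ a := by
      obtain ⟨b, rfl⟩ := Nat.exists_eq_add_of_le' ha
      rw [pow_succ]
      exact Nat.mul_le_mul_right 2 b.lt_two_pow_self
    calc GCDMonoid.lcm a S.lcm * 2 ^ (S.card + 1) ≤ a * S.lcm * 2 ^ (S.card + 1) :=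
          Nat.mul_le_mul_right _ hlcm
      _ = (a * 2) * (S.lcm * 2 ^ S.card) := by ring
      _ ≤ 2 ^ a * 2 ^ S.sum := Nat.mul_le_mul h2a ih
      _ = 2 ^ (a + S.sum) := (pow_add _ _ _).symm

/-- A permutation of `m ≥ 1` points has order at most `2 ^ (m - 1)`, and less than that if
`m ≥ 3`. -/
theorem two_mul_orderOf_perm_le {κ : Type*} [Fintype κ] (τ : Equiv.Perm κ)
    (hpos : 1 ≤ Fintype.card κ) :
    2 * orderOf τ ≤ 2 ^ Fintype.card κ ∧
      (3 ≤ Fintype.card κ → 2 * orderOf τ < 2 ^ Fintype.card κ) := by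
  classical
  have hsum : τ.cycleType.sum ≤ Fintype.card κ := by
    rw [Equiv.Perm.sum_cycleType]; exact Finset.card_le_univ _
  have hpow := Nat.pow_le_pow_right (n := 2) two_pos hsum
  have hlcm := τ.cycleType.lcm_le_two_pow fun a ha =>
    one_le_two.trans (Equiv.Perm.two_le_of_mem_cycleType ha)
  rw [Equiv.Perm.lcm_cycleType] at hlcm
  rcases hcard : τ.cycleType.card with _ | _ | c
  · have h1 : orderOf τ = 1 := by
      rw [Multiset.card_eq_zero, Equiv.Perm.cycleType_eq_zero] at hcard
      rw [hcard, orderOf_one]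
    rw [h1]
    have h2 := Nat.pow_le_pow_right (n := 2) two_pos hpos
    refine ⟨by simpa using h2, fun h3 => ?_⟩
    have := Nat.pow_le_pow_right (n := 2) two_pos h3
    omega
  · refine ⟨by rw [hcard] at hlcm; omega, fun h3 => ?_⟩
    -- A single cycle has order at most `m`, and `2 * m < 2 ^ m` for `m ≥ 3`.
    have hord : orderOf τ ≤ Fintype.card κ := by
      obtain ⟨a, ha⟩ := Multiset.card_eq_one.mp hcard
      rw [← Equiv.Perm.lcm_cycleType]
      rw [ha, Multiset.sum_singleton] at hsum
      rw [ha, Multiset.lcm_singleton]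
      simpa using hsum
    have hlt : ∀ m, 3 ≤ m → 2 * m < 2 ^ m := by
      intro m hm
      induction m, hm using Nat.le_induction with
      | base => norm_num
      | succ m hm ih => rw [pow_succ]; omega
    exact lt_of_le_of_lt (Nat.mul_le_mul_left 2 hord) (hlt _ h3)
  · have h0 := orderOf_pos τ
    have hc : 4 ≤ 2 ^ τ.cycleType.card := by
      rw [hcard, pow_succ, pow_succ]
      have := Nat.one_le_two_pow (n := c)
      omega
    have : orderOf τ * 4 ≤ 2 ^ Fintype.card κ :=
      (Nat.mul_le_mul_left _ hc).trans (hlcm.trans hpow)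
    exact ⟨by omega, fun _ => by omega⟩

/-! ### Periods of nonexpansive analytic maps -/

theorem mainTheorem4 (n : ℕ) (f : (Fin n → ℝ) → (Fin n → ℝ))
    (hf_analytic : AnalyticOnNhd ℝ f Set.univ)
    (hf_nonexp : ∀ x y : Fin n → ℝ, ‖f x - f y‖ ≤ ‖x - y‖)
    (x : Fin n → ℝ) (hx : x ∈ Function.periodicPts f) :
    Function.minimalPeriod f x ≤ 2 ^ n ∧
      (3 ≤ n → Function.minimalPeriod f x < 2 ^ n) := by
  have hp := minimalPeriod_pos_of_mem_periodicPts hx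
  set p := minimalPeriod f x with hpdef
  have hg : AnalyticOnNhd ℝ f^[p] Set.univ := by
    generalize p = k
    induction k with
    | zero => exact analyticOnNhd_id
    | succ k ih =>
      rw [iterate_succ']
      exact hf_analytic.comp ih (Set.mapsTo_univ _ _)
  have hne : ∀ y z, ‖f^[p] y - f^[p] z‖ ≤ ‖y - z‖ := by
    generalize p = k
    induction k with
    | zero => exact fun y z => le_rfl
    | succ k ih =>
      intro y z
      rw [iterate_succ_apply', iterate_succ_apply']
      exact (hf_nonexp _ _).trans (ih y z)
  obtain ⟨u, hu⟩ := exists_isFixedPt_of_mem_periodicPts hf_nonexp hx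
  have hgu : f^[p] u = u := iterate_fixed hu p
  have hgx : f^[p] x = x := iterate_minimalPeriod
  obtain ⟨κ, _, Φ, hcard, hΦu⟩ := exists_isometryEquiv_fixedPoints hg hne hgu
  rw [Fintype.card_fin] at hcard
  -- On the fixed points of `f^[p]`, `f` is bijective with inverse `f^[p - 1]`, hence isometric.
  have hmaps : ∀ y ∈ fixedPoints f^[p], f y ∈ fixedPoints f^[p] := fun y hy => by
    have hy : f^[p] y = y := hy
    change f^[p] (f y) = f y
    rw [← iterate_succ_apply, iterate_succ_apply', hy]
  let F : fixedPoints f^[p] → fixedPoints f^[p] := fun y => ⟨f y, hmaps y y.2⟩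
  have hFiter : ∀ k y, (F^[k] y).1 = f^[k] y.1 := fun k y => by
    induction k with
    | zero => rfl
    | succ k ih => rw [iterate_succ_apply', iterate_succ_apply', ← ih]
  have hFp : ∀ y, F^[p - 1] (F y) = y := fun y => Subtype.ext <| by
    rw [← iterate_succ_apply, Nat.succ_eq_add_one, Nat.sub_add_cancel hp, hFiter]
    exact y.2
  have hFsurj : Surjective F := fun y => ⟨F^[p - 1] y, by
    rw [← iterate_succ_apply' F, iterate_succ_apply, hFp]⟩
  have hFiso : Isometry F := by
    have hlip : ∀ k y z, dist (F^[k] y) (F^[k] z) ≤ dist y z := fun k y z => by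
      induction k with
      | zero => exact le_rfl
      | succ k ih =>
        rw [iterate_succ_apply', iterate_succ_apply']
        refine le_trans ?_ ih
        simp only [Subtype.dist_eq, dist_eq_norm]
        exact hf_nonexp _ _
    refine Isometry.of_dist_eq fun y z => le_antisymm (hlip 1 y z) ?_
    have := hlip (p - 1) (F y) (F z)
    rwa [hFp, hFp] at this
  let F' : fixedPoints f^[p] ≃ᵢ fixedPoints f^[p] :=
    ⟨Equiv.ofBijective F ⟨hFiso.injective, hFsurj⟩, hFiso⟩
  let T : (κ → ℝ) ≃ᵢ (κ → ℝ) := (Φ.symm.trans F').trans Φ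
  have hT : ∀ y, T (Φ y) = Φ (F y) := fun y => by
    change Φ (F (Φ.symm (Φ y))) = _
    rw [Φ.symm_apply_apply]
  have hT0 : T 0 = 0 := by
    rw [← hΦu, hT]
    exact congrArg Φ (Subtype.ext hu)
  have hTiter : ∀ k y, T^[k] (Φ y) = Φ (F^[k] y) := fun k y => by
    induction k with
    | zero => rfl
    | succ k ih => rw [iterate_succ_apply', iterate_succ_apply', ih, hT]
  obtain ⟨τ, s, hs, hL⟩ := (T.toRealLinearIsometryEquivOfMapZero hT0).exists_signed_perm
  rcases Nat.eq_zero_or_pos (Fintype.card κ) with h0 | h0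
  · -- If there are no coordinates, then `x` is the fixed point `u`.
    have hκ := Fintype.card_eq_zero_iff.mp h0
    have hxu : x = u := congrArg Subtype.val
      (Φ.injective (Subsingleton.elim (Φ ⟨x, hgx⟩) (Φ ⟨u, hgu⟩)))
    have hp1 : p = 1 := by
      rw [hpdef, minimalPeriod_eq_one_iff_isFixedPt, hxu]
      exact hu
    rw [hp1]
    exact ⟨Nat.one_le_two_pow, fun h3 => Nat.one_lt_two_pow (by omega)⟩
  · have hTx : T^[2 * orderOf τ] (Φ ⟨x, hgx⟩) = Φ ⟨x, hgx⟩ := iterate_two_mul_orderOf_eq hs hL _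
    rw [hTiter] at hTx
    have hfx : f^[2 * orderOf τ] x = x := by
      have := congrArg Subtype.val (Φ.injective hTx)
      rwa [hFiter] at this
    have hple : p ≤ 2 * orderOf τ :=
      IsPeriodicPt.minimalPeriod_le (Nat.mul_pos two_pos (orderOf_pos τ)) hfx
    obtain ⟨hle, hlt⟩ := two_mul_orderOf_perm_le τ h0
    have hpow := Nat.pow_le_pow_right (n := 2) two_pos hcard
    refine ⟨by omega, fun h3 => ?_⟩
    rcases Nat.lt_or_ge (Fintype.card κ) 3 with hm | hm
    · have := Nat.pow_lt_pow_right (a := 2) one_lt_two (hm.trans_le h3)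
      omega
    · have := hlt hm
      omega
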